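/- Let $(X,\Phi;Y,\Phi^\vee)$ be the root datum of a split, almost simple, simply connected group $G$; thus $\Phi$ is reduced and irreducible and $Y$ (the cocharacter lattice) is spanned by the coroots. Let $W$ be the Weyl group, acting on $Y$, and fix simple roots $\Delta\subset\Phi$. Let $\widetilde G^{(n)}$ ($n\ge 1$) be the Brylinski--Deligne cover of $G$ attached to a (not necessarily symmetric) bilinear form $D:Y\times Y\to\mathbb Z$ such that $Q(y)=D(y,y)$ is $W$-invariant. Put $B_Q(y,z)=D(y,z)+D(z,y)$, $$Y_{Q,n}=\{y\in Y:\ n\mid B_Q(y,z)\ \text{for all } z\in Y\},\qquad \mathscr X_{Q,n}=Y/Y_{Q,n},$$ with the induced action of $W$. Assume that $Q(\alpha^\vee)=1$ for every short coroot $\alpha^\vee$ (all coroots being short if they have the same length). Call a $W$-orbit $\mathcal O\subset\mathscr X_{Q,n}$ *splitting* if there is a $W$-equivariant map $s:\mathcal O\to Y$ such that the class of $s(x)$ in $\mathscr X_{Q,n}$ is $x$ for every $x\in\mathcal O$. 1. Suppose that $\widetilde G^{(n)}$ is oasitic: writing the highest coroot as $\sum_{\alpha\in\Delta}c_\alpha^\sharp\alpha^\vee$,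 one has $\gcd(n,c_\alpha^\sharp)=1$ for every $\alpha\in\Delta$, and $\gcd(n,\det B_Q)=1$, where $\det B_Q$ is the determinant of the matrix of $B_Q$ in a $\mathbb Z$-basis of $Y$. Then every $W$-orbit $\mathcal O\subset\mathscr X_{Q,n}$ is splitting. 2. Suppose that $\gcd(n,\mathscr I_\Delta)=1$, where $\mathscr I_\Delta$ is the index of the root system $\Phi$, that is, the index of the root lattice in the weight lattice. Then every $W$-orbit $\mathcal O\subset\mathscr X_{Q,n}$ containing a point whose stabilizer in $W$ is a parabolic subgroup (a conjugate of the subgroup generated by the reflections $w_\alpha$, $\alpha\in J$, for some $J\subseteq\Delta$) is splitting. -/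

import Mathlib

namespace BDCover

/-! ### Root data

The root datum `(X, Φ; Y, Φ^∨)` of a split connected reductive group `(G, T)` is a reduced
`P : RootDatum ι X Y` with `ι` finite and with `X`, `Y` finitely generated free; `P.root i` and
`P.coroot i` are `α` and `α^∨`. -/

section RootData

variable {ι X Y : Type*} [AddCommGroup X] [AddCommGroup Y]

/-- The Weyl group, as the Weyl group of the coroot system; it acts on the cocharacter lattice `Y`
and is generated by `y ↦ y - ⟨α, y⟩ α^∨`. -/
noncomputable abbrev Weyl (P : RootDatum ι X Y) : Subgroup (RootPairing.Aut P.flip) := P.flip.weylGroup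

/-- The reflection `w_α`, as an element of the Weyl group. -/
noncomputable abbrev refl (P : RootDatum ι X Y) (i : ι) : Weyl P := RootPairing.weylGroup.ofIdx P.flip i

/-- The reflection `w_α` acts on `Y` by the usual formula. -/
theorem refl_smul (P : RootDatum ι X Y) (i : ι) (y : Y) :
    refl P i • y = y - P.toLinearMap (P.root i) y • P.coroot i := rfl

/-- Simply connected (and semisimple): the coroots span `Y`. -/
def IsSimplyConnected (P : RootDatum ι X Y) : Prop := P.corootSpan ℤ = ⊤

/-- The root system is irreducible: it is nonempty, and it is not the union of two nonempty
mutually orthogonal parts. For a semisimple group this says that the group is almost simple. -/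
def IsAlmostSimple (P : RootDatum ι X Y) : Prop :=
  Nonempty ι ∧ ∀ S : Set ι, S.Nonempty → (∀ i ∈ S, ∀ j ∉ S, P.pairing i j = 0) → S = Set.univ

/-- `α^∨` is short: it has minimal length for the Weyl-invariant form
`(x, y) ↦ ∑_{β ∈ Φ} ⟨β, x⟩ ⟨β, y⟩`. If all coroots have the same length, all are short. -/
def IsShortCoroot [Fintype ι] (P : RootDatum ι X Y) (i : ι) : Prop :=
  ∀ j, P.CorootForm (P.coroot i) (P.coroot i) ≤ P.CorootForm (P.coroot j) (P.coroot j)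

/-- `α^∨` is the highest coroot with respect to the simple coroots: its difference with any coroot
is a nonnegative integral combination of simple coroots. -/
def IsHighestCoroot {P : RootDatum ι X Y} (b : P.Base) (i : ι) : Prop :=
  ∀ j, P.coroot i - P.coroot j ∈ AddSubmonoid.closure (P.coroot '' b.support)

/-- Characters of `T`, restricted to the coroot lattice, as elements of the weight lattice
`Hom(Y^sc, ℤ)`. -/
def toWeightLattice (P : RootDatum ι X Y) : X →ₗ[ℤ] Module.Dual ℤ (P.corootSpan ℤ) :=
  (P.corootSpan ℤ).subtype.dualMap ∘ₗ P.toLinearMap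

/-- The index of the root system: the index of the root lattice in the weight lattice. -/
noncomputable def rootIndex (P : RootDatum ι X Y) : ℕ :=
  ((P.rootSpan ℤ).map (toWeightLattice P)).toAddSubgroup.index

/-- The standard parabolic subgroup `W_J` generated by the reflections in a set `J` of roots. -/
noncomputable def standardParabolic (P : RootDatum ι X Y) (J : Set ι) : Subgroup (Weyl P) :=
  Subgroup.closure (refl P '' J)

/-- Parabolic subgroups of the Weyl group: the conjugates of the `W_J`, with `J` a set of simple
roots. -/
def IsParabolic {P : RootDatum ι X Y} (b : P.Base) (H : Subgroup (Weyl P)) : Prop :=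
  ∃ J : Set ι, J ⊆ b.support ∧ ∃ w : Weyl P,
    H = (standardParabolic P J).map (MulAut.conj w).toMonoidHom

end RootData

/-! ### Covers -/

/-- An `n`-fold Brylinski--Deligne cover of the split group with root datum `P`, incarnated by a
bilinear form `D` on `Y` (not necessarily symmetric) such that `Q(y) = D(y, y)` is
Weyl-invariant. -/
structure Cover {ι X Y : Type*} [AddCommGroup X] [AddCommGroup Y] (P : RootDatum ι X Y) where
  D : Y →ₗ[ℤ] Y →ₗ[ℤ] ℤ
  invariant : ∀ (w : Weyl P) (y : Y), D (w • y) (w • y) = D y y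
  n : ℕ
  n_pos : 0 < n

namespace Cover

variable {ι X Y : Type*} [AddCommGroup X] [AddCommGroup Y] {P : RootDatum ι X Y} (C : Cover P)

/-- The quadratic form `Q`. -/
def Q (y : Y) : ℤ := C.D y y

/-- The symmetric bilinear form `B_Q(y, z) = D(y, z) + D(z, y)`. -/
def B : LinearMap.BilinForm ℤ Y := C.D + C.D.flip

theorem B_apply (y z : Y) : C.B y z = C.D y z + C.D z y := rfl

theorem B_eq (y z : Y) : C.B y z = C.Q (y + z) - C.Q y - C.Q z := by
  simp only [B_apply, Q, map_add, LinearMap.add_apply]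
  ring

theorem B_smul_smul (w : Weyl P) (y z : Y) : C.B (w • y) (w • z) = C.B y z := by
  simp only [B_eq, Q, ← smul_add, C.invariant]

/-- `det(B_Q)`, computed in a `ℤ`-basis of `Y`. -/
noncomputable def detB [Module.Free ℤ Y] [Module.Finite ℤ Y] : ℤ := by
  classical
  exact (LinearMap.BilinForm.toMatrix (Module.Free.chooseBasis ℤ Y) C.B).det

/-- `det(B_Q)` does not depend on the basis. -/
theorem detB_eq [Module.Free ℤ Y] [Module.Finite ℤ Y] {κ : Type*} [Fintype κ] [DecidableEq κ]
    (v : Module.Basis κ ℤ Y) : C.detB = (Matrix.of fun i j => C.B (v i) (v j)).det := by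
  classical
  set u := Module.Free.chooseBasis ℤ Y
  let e := u.indexEquiv v
  have h1 : (Matrix.of fun i j => C.B (v i) (v j)).det
      = (LinearMap.BilinForm.toMatrix (v.reindex e.symm) C.B).det := by
    rw [← Matrix.det_submatrix_equiv_self e]
    congr 1
    ext i j
    simp [LinearMap.BilinForm.toMatrix_apply]
  have h2 := LinearMap.BilinForm.toMatrix_mul_basis_toMatrix u (v.reindex e.symm) C.B
  have h3 : IsUnit (u.toMatrix (v.reindex e.symm)).det := by
    rw [← Module.Basis.det_apply]
    exact u.isUnit_det (v.reindex e.symm)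
  rw [h1, ← h2, Matrix.det_mul, Matrix.det_mul, Matrix.det_transpose]
  show (LinearMap.BilinForm.toMatrix u C.B).det = _
  rcases Int.isUnit_iff.1 h3 with h | h <;> rw [h] <;> ring

/-- `Y_{Q,n} = Y ∩ n Y^*`, where `Y^*` is the dual lattice with respect to `B_Q`: all `y ∈ Y` such
that `B_Q(y / n, z)` is an integer for every `z ∈ Y`. -/
def YQn : Submodule ℤ Y where
  carrier := {y | ∀ z, (C.n : ℤ) ∣ C.B y z}
  zero_mem' z := by simp
  add_mem' ha hb z := by
    rw [map_add, LinearMap.add_apply]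
    exact dvd_add (ha z) (hb z)
  smul_mem' c a ha z := by
    rw [map_smul, LinearMap.smul_apply]
    exact (ha z).mul_left c

theorem mem_YQn {y : Y} : y ∈ C.YQn ↔ ∀ z, (C.n : ℤ) ∣ C.B y z := Iff.rfl

theorem smul_mem_YQn (w : Weyl P) {y : Y} (hy : y ∈ C.YQn) : w • y ∈ C.YQn := by
  intro z
  have h := hy (w⁻¹ • z)
  rwa [← C.B_smul_smul w, smul_inv_smul] at h

/-- The quotient `𝒳_{Q,n} = Y / Y_{Q,n}`. -/
abbrev XQn : Type _ := Y ⧸ C.YQn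

/-- The class `ŷ` of `y`. -/
abbrev proj (y : Y) : C.XQn := Submodule.Quotient.mk y

/-- The action of the Weyl group on `𝒳_{Q,n}` induced by the one on `Y`. -/
noncomputable instance instMulActionXQn : MulAction (Weyl P) C.XQn where
  smul w := Quotient.map' (w • ·) (fun a b h => by
    have h' : a - b ∈ C.YQn := (Submodule.quotientRel_def _).1 h
    refine (Submodule.quotientRel_def _).2 ?_
    rw [← smul_sub]
    exact C.smul_mem_YQn w h')
  one_smul x := by
    induction x using Submodule.Quotient.induction_on with
    | _ y => exact congrArg C.proj (one_smul (Weyl P) y)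
  mul_smul w w' x := by
    induction x using Submodule.Quotient.induction_on with
    | _ y => exact congrArg C.proj (mul_smul w w' y)

theorem smul_mk (w : Weyl P) (y : Y) : w • C.proj y = C.proj (w • y) := rfl

/-- The `W`-orbit of `x ∈ 𝒳_{Q,n}` is splitting: over it, `Y → 𝒳_{Q,n}` has a `W`-equivariant
section. -/
def IsSplitting (x : C.XQn) : Prop :=
  ∃ s : MulAction.orbit (Weyl P) x → Y,
    (∀ o, C.proj (s o) = o) ∧ ∀ (w : Weyl P) o, s (w • o) = w • s o

/-- The cover is oasitic: `n` is coprime to `det(B_Q)` and to all coefficients of the highest coroot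
in terms of the simple coroots. -/
def IsOasitic [Module.Free ℤ Y] [Module.Finite ℤ Y] (b : P.Base) : Prop :=
  (∃ i, IsHighestCoroot b i ∧ ∃ c : b.support → ℤ,
    P.coroot i = ∑ a, c a • P.coroot a ∧ ∀ a, Int.gcd C.n (c a) = 1) ∧
  Int.gcd C.n C.detB = 1

end Cover

end BDCover

-- An orbit splits as soon as one of its points has a lift to `Y` fixed by the stabilizer of that
-- point (`isSplitting_of_stabilizer_le`).
--
-- Part 1. The map `y ↦ B_Q(y, ·)` carries `Y` to `X` and `Y_{Q,n}` into `nX`; since `n` is prime to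
-- `det B_Q`, lifting modulo `Y_{Q,n}` becomes lifting modulo `nX`. If `wξ = ξ + nν`, then `nν` lies
-- in the root lattice, and so does `ν`, because `det B_Q` kills the weight lattice modulo the root
-- lattice. Thus `w` is the linear part of an affine Weyl group element fixing `ξ`. Move `ξ` into
-- the closed alcove dilated by `n`: its affine stabilizer is generated by the reflections in the
-- walls through `ξ`, so a weight vanishing on the corresponding coroots is fixed
-- (`smul_eq_of_smul_eq_add`). Such a weight exists in `ξ + nX` because the coefficients of the
-- highest coroot are invertible modulo `n` (`exists_modEq_of_mem_alcove`).
--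
-- Part 2. With `k` the index, `k` times each fundamental coweight lies in `Y`. As `k` is invertible
-- modulo `n`, subtracting multiples of these makes a lift orthogonal to the simple roots in `J`,
-- hence fixed by `W_J`.

open Module

namespace RootPairing

-- Automorphisms and reflections.

section Aut

variable {ι M N : Type*} [AddCommGroup M] [AddCommGroup N] (P : RootPairing ι ℤ M N)

lemma aut_smul_root (g : P.Aut) (i : ι) : g • P.root i = P.root (g • i) :=
  (Equiv.root_indexEquiv_eq_smul P i g).symm

lemma toLinearMap_aut_smul_coroot (g : P.Aut) (x : M) (i : ι) :
    P.toLinearMap (g • x) (P.coroot (g • i)) = P.toLinearMap x (P.coroot i) := by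
  have h1 := LinearMap.congr_fun
    (Hom.weight_coweight_transpose_apply P P (P.coroot (g • i)) g.toHom) x
  have h2 := Hom.coroot_coweightMap_apply P P (g • i) g.toHom
  have h3 : g.toHom.indexEquiv.symm (g • i) = i := g.toHom.indexEquiv.symm_apply_apply i
  rw [h3] at h2
  rw [h2] at h1
  exact h1

lemma toLinearMap_aut_smul (g : P.Aut) (x : M) (i : ι) :
    P.toLinearMap (g • x) (P.coroot i) = P.toLinearMap x (P.coroot (g⁻¹ • i)) := by
  rw [← toLinearMap_aut_smul_coroot P g x, smul_inv_smul]

lemma reflection_smul_eq (i : ι) (x : M) :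
    Equiv.reflection P i • x = x - P.toLinearMap x (P.coroot i) • P.root i :=
  P.reflection_apply i x

lemma reflection_smul_index (i j : ι) :
    Equiv.reflection P i • j = P.reflectionPerm i j := rfl

lemma reflection_mul_self (i : ι) : Equiv.reflection P i * Equiv.reflection P i = 1 := by
  nth_rewrite 1 [← Equiv.reflection_inv]
  exact inv_mul_cancel _

lemma aut_ext {g h : P.Aut} (H : ∀ x : M, g • x = h • x) : g = h :=
  Equiv.weightHom_injective P (LinearEquiv.ext H)

lemma aut_smul_zsmul (g : P.Aut) (c : ℤ) (x : M) : g • (c • x) = c • g • x :=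
  smul_comm g c x

lemma mul_reflection (g : P.Aut) (i : ι) :
    g * Equiv.reflection P i = Equiv.reflection P (g • i) * g := by
  refine P.aut_ext fun x => ?_
  rw [mul_smul, mul_smul, reflection_smul_eq, reflection_smul_eq, toLinearMap_aut_smul_coroot,
    smul_sub, aut_smul_zsmul, aut_smul_root]

lemma toLinearMap_coroot_reflectionPerm_self (x : M) (i : ι) :
    P.toLinearMap x (P.coroot (P.reflectionPerm i i)) = - P.toLinearMap x (P.coroot i) := by
  simp

end Aut

-- Simple reflections and freeness of the Weyl group on positive systems.

section Simple

variable {ι M N : Type*} [Finite ι] [AddCommGroup M] [AddCommGroup N]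
  {P : RootPairing ι ℤ M N} [P.IsReduced] (b : P.Base)

lemma Base.reflection_mem_closure_simple (i : ι) :
    Equiv.reflection P i ∈ Subgroup.closure (Equiv.reflection P '' b.support) := by
  refine b.induction_reflect i (p := fun i => Equiv.reflection P i ∈ _) ?_ ?_ ?_
  · intro i hi
    convert hi using 1
    have h := P.mul_reflection (Equiv.reflection P i) i
    rw [reflection_smul_index] at h
    exact (mul_right_cancel h).symm
  · exact fun i hi => Subgroup.subset_closure ⟨i, hi, rfl⟩
  · intro i j hi hj
    have h := P.mul_reflection (Equiv.reflection P j) i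
    rw [reflection_smul_index, ← mul_inv_eq_iff_eq_mul] at h
    rw [← h]
    have hj' : Equiv.reflection P j ∈ Subgroup.closure (Equiv.reflection P '' b.support) :=
      Subgroup.subset_closure ⟨j, hj, rfl⟩
    exact mul_mem (mul_mem hj' hi) (inv_mem hj')

lemma Base.exists_list_of_mem_weylGroup {g : P.Aut} (hg : g ∈ P.weylGroup) :
    ∃ l : List b.support, g = (l.map fun i => Equiv.reflection P i.1).prod := by
  have hle : P.weylGroup ≤ Subgroup.closure (Equiv.reflection P '' b.support) := by
    rw [weylGroup, Subgroup.closure_le]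
    rintro _ ⟨i, rfl⟩
    exact b.reflection_mem_closure_simple i
  replace hg := hle hg
  clear hle
  induction hg using Subgroup.closure_induction with
  | mem x hx => obtain ⟨i, hi, rfl⟩ := hx; exact ⟨[⟨i, hi⟩], by simp⟩
  | one => exact ⟨[], rfl⟩
  | mul x y _ _ h1 h2 =>
    obtain ⟨l1, rfl⟩ := h1
    obtain ⟨l2, rfl⟩ := h2
    exact ⟨l1 ++ l2, by simp⟩
  | inv x _ h =>
    obtain ⟨l, rfl⟩ := h
    refine ⟨l.reverse, ?_⟩
    rw [List.prod_inv_reverse, List.map_reverse, List.map_map]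
    congr 3
    exact funext fun i => Equiv.reflection_inv P i.1

variable [Module.Free ℤ M] [Module.Free ℤ N]

/-- Some letter `s_i` of the word turns a positive coroot negative. A simple reflection does this
only to its own coroot, so the letters `w` to its right send `j` to `i`. Then `s_i w = w s_j`, and
the letter can be traded for `s_j` at the right end. -/
lemma Base.exchange (l : List b.support) (j : b.support)
    (h : ¬ b.flip.IsPos ((l.map fun i => Equiv.reflection P i.1).prod • j.1)) :
    ∃ l' : List b.support, l'.length + 1 = l.length ∧
      (l.map fun i => Equiv.reflection P i.1).prod =
        (l'.map fun i => Equiv.reflection P i.1).prod * Equiv.reflection P j.1 := by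
  induction l with
  | nil =>
    refine absurd ?_ h
    simpa using Base.isPos_of_mem_support (b := b.flip) j.2
  | cons i t ih =>
    set w := (t.map fun i => Equiv.reflection P i.1).prod with hw
    have hcons : (((i :: t).map fun i => Equiv.reflection P i.1).prod)
        = Equiv.reflection P i.1 * w := by simp [hw]
    rw [hcons] at h ⊢
    by_cases hp : b.flip.IsPos (w • j.1)
    · by_cases hi : w • j.1 = i.1
      · refine ⟨t, rfl, ?_⟩
        rw [← hw, mul_reflection, hi]
      · refine absurd ?_ h
        rw [mul_smul]
        exact hp.reflectionPerm (b := b.flip) i.2 hi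
    · obtain ⟨l', h1, h2⟩ := ih hp
      exact ⟨i :: l', by simp [h1], by simp [h2]⟩

/-- The Weyl group acts freely on the set of systems of positive roots. -/
lemma Base.eq_one_of_forall_isPos {g : P.Aut} (hg : g ∈ P.weylGroup)
    (h : ∀ i, b.flip.IsPos i → b.flip.IsPos (g • i)) : g = 1 := by
  obtain ⟨l, hl⟩ := b.exists_list_of_mem_weylGroup hg
  clear hg
  induction hn : l.length using Nat.strong_induction_on generalizing l with
  | _ n ih =>
    rcases l.eq_nil_or_concat with rfl | ⟨t, j, rfl⟩
    · simpa using hl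
    have hl' : g = (t.map fun i => Equiv.reflection P i.1).prod * Equiv.reflection P j.1 := by
      simpa using hl
    -- Since `g` keeps `j` positive, the word without its last letter `s_j` makes it negative;
    -- exchange then writes `g` with two letters fewer.
    have hneg : ¬ b.flip.IsPos ((t.map fun i => Equiv.reflection P i.1).prod • j.1) := by
      have h1 : (t.map fun i => Equiv.reflection P i.1).prod = g * Equiv.reflection P j.1 := by
        rw [hl', mul_assoc, reflection_mul_self, mul_one]
      have h2 : (g * Equiv.reflection P j.1) • j.1
          = P.flip.reflectionPerm (g • j.1) (g • j.1) := by
        rw [mul_reflection, mul_smul]; rfl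
      rw [h1, h2]
      have h3 := h _ (Base.isPos_of_mem_support (b := b.flip) j.2)
      have h4 := Base.IsPos.neg_iff_not b.flip (g • j.1)
      exact fun h5 => h4.1 h5 h3
    obtain ⟨l', hlen, hprod⟩ := b.exchange t j hneg
    have hg' : g = (l'.map fun i => Equiv.reflection P i.1).prod := by
      rw [hl', hprod, mul_assoc, reflection_mul_self, mul_one]
    refine ih l'.length ?_ l' hg' rfl
    rw [← hn]
    simp
    omega

end Simple

-- Minuscule weights in the root lattice.

section Minuscule

variable {ι M N : Type*} [AddCommGroup M] [AddCommGroup N]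
  {P : RootPairing ι ℤ M N}

lemma exists_multiset_of_mem_rootSpan {x : M} (hx : x ∈ P.rootSpan ℤ) :
    ∃ s : Multiset ι, x = (s.map P.root).sum := by
  induction hx using Submodule.span_induction with
  | mem x hx => obtain ⟨i, rfl⟩ := hx; exact ⟨{i}, by simp⟩
  | zero => exact ⟨0, by simp⟩
  | add x y _ _ h1 h2 =>
    obtain ⟨s, rfl⟩ := h1
    obtain ⟨t, rfl⟩ := h2
    exact ⟨s + t, by simp⟩
  | smul c x _ h =>
    obtain ⟨s, rfl⟩ := h
    have hneg : ∃ t : Multiset ι, -(s.map P.root).sum = (t.map P.root).sum := by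
      refine ⟨s.map fun i => P.reflectionPerm i i, ?_⟩
      rw [← Multiset.sum_map_neg, Multiset.map_map]
      exact congrArg Multiset.sum (Multiset.map_congr rfl fun i _ => by simp)
    obtain ⟨t, ht⟩ := hneg
    obtain ⟨m, rfl | rfl⟩ := c.eq_nat_or_neg
    · exact ⟨m • s, by simp [Multiset.map_nsmul, Multiset.sum_nsmul]⟩
    · refine ⟨m • t, ?_⟩
      rw [Multiset.map_nsmul, Multiset.sum_nsmul, ← ht]
      simp

/-- The root lattice contains no nonzero minuscule weight. -/
lemma eq_zero_of_mem_rootSpan_of_le_one [Finite ι] {x : M} (hx : x ∈ P.rootSpan ℤ)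
    (h : ∀ i, P.toLinearMap x (P.coroot i) ≤ 1) : x = 0 := by
  classical
  obtain ⟨s, hs⟩ := exists_multiset_of_mem_rootSpan hx
  induction hn : s.card using Nat.strong_induction_on generalizing s with
  | _ n ih =>
    induction s using Multiset.induction_on with
    | empty => simpa using hs
    | cons i t _ =>
      -- Two roots with negative pairing either cancel or add up to a root, which shortens the sum.
      -- If no summand pairs negatively with `i`, the sum pairs to at least 2 with the coroot of
      -- `i`.
      by_cases hneg : ∃ j ∈ t, P.pairing j i < 0
      · obtain ⟨j, hj, hji⟩ := hneg
        obtain ⟨u, rfl⟩ := Multiset.exists_cons_of_mem hj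
        by_cases h0 : P.root j = - P.root i
        · refine ih u.card ?_ u ?_ rfl
          · rw [← hn]; simp
          · rw [hs]; simp [h0]
        · obtain ⟨k, hk⟩ := P.root_add_root_mem_of_pairingIn_neg (i := j) (j := i)
            (by rwa [← P.algebraMap_pairingIn ℤ] at hji) h0
          refine ih (k ::ₘ u).card ?_ (k ::ₘ u) ?_ rfl
          · rw [← hn]; simp
          · rw [hs]; simp [hk]; abel
      · push Not at hneg
        exfalso
        have h1 := h i
        have h2 : ∀ u : Multiset ι, (∀ j ∈ u, 0 ≤ P.pairing j i) →
            0 ≤ P.toLinearMap (u.map P.root).sum (P.coroot i) := by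
          intro u
          induction u using Multiset.induction_on with
          | empty => simp
          | cons j u ihu =>
            intro hu
            have h3 := ihu fun j hj => hu j (Multiset.mem_cons_of_mem hj)
            have h4 := hu j (Multiset.mem_cons_self j u)
            rw [Multiset.map_cons, Multiset.sum_cons, map_add, LinearMap.add_apply]
            rw [← root_coroot_eq_pairing] at h4
            exact add_nonneg h4 h3
        have h5 := h2 t hneg
        rw [hs, Multiset.map_cons, Multiset.sum_cons, map_add, LinearMap.add_apply,
          P.root_coroot_two] at h1
        omega

end Minuscule

-- The invariant form and distances.

section Norm

variable {ι M N : Type*} [Fintype ι] [AddCommGroup M] [AddCommGroup N]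
  (P : RootPairing ι ℤ M N)

lemma rootForm_self_nonneg (x : M) : 0 ≤ P.RootForm x x :=
  (P.rootForm_self_sum_of_squares x).nonneg

lemma rootForm_root_self_pos (i : ι) : 0 < P.RootForm (P.root i) (P.root i) := by
  rw [rootForm_root_self]
  refine Finset.sum_pos' (fun j _ => mul_self_nonneg _) ⟨i, Finset.mem_univ _, ?_⟩
  simp

lemma two_mul_rootForm_root (x : M) (i : ι) :
    2 * P.RootForm x (P.root i)
      = P.toLinearMap x (P.coroot i) * P.RootForm (P.root i) (P.root i) := by
  have h := P.rootForm_reflection_reflection_apply i x (P.root i)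
  rw [reflection_apply_self, reflection_apply] at h
  simp only [map_sub, map_neg, map_smul, LinearMap.sub_apply, LinearMap.smul_apply,
    smul_eq_mul] at h
  change -(_ - P.toLinearMap x (P.coroot i) * _) = _ at h
  linarith

/-- Leaving `a` free covers affine reflections as well as linear ones: whether a reflection brings a
point nearer to another is then decided by the sign of a product. -/
lemma rootForm_sub_smul_root (x : M) (a : ℤ) (i : ι) :
    P.RootForm (x - a • P.root i) (x - a • P.root i) = P.RootForm x x
      + a * (a - P.toLinearMap x (P.coroot i)) * P.RootForm (P.root i) (P.root i) := by
  have h := P.two_mul_rootForm_root x i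
  have hs : P.RootForm (P.root i) x = P.RootForm x (P.root i) :=
    P.rootForm_symmetric.eq _ _
  simp only [map_sub, map_smul, LinearMap.sub_apply, LinearMap.smul_apply, smul_eq_mul, hs]
  linear_combination (-a) * h

end Norm

lemma exists_forall_le_of_nonneg {α : Type*} (f : α → ℤ) (hf : ∀ a, 0 ≤ f a) (p : α → Prop)
    (hp : ∃ a, p a) : ∃ a, p a ∧ ∀ a', p a' → f a ≤ f a' := by
  obtain ⟨a, ha, hmin⟩ := (measure fun a => (f a).toNat).wf.has_min {a | p a} hp
  refine ⟨a, ha, fun a' ha' => ?_⟩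
  have h : ¬ (f a').toNat < (f a).toNat := hmin a' ha'
  have := hf a
  have := hf a'
  omega

-- Fundamental weights, heights and the root lattice.

section Weights

variable {ι M N : Type*} [AddCommGroup M] [AddCommGroup N]
  {P : RootPairing ι ℤ M N} (b : P.Base)

open Classical in
-- The simple coroots form a basis of `N`, and `M` is the full dual of `N`, so it contains the dual
-- basis.
lemma Base.exists_fundamentalWeight (hN : P.corootSpan ℤ = ⊤) :
    ∃ ω : b.support → M, ∀ a a' : b.support,
      P.toLinearMap (ω a) (P.coroot a') = if a' = a then 1 else 0 := by
  have hli : LinearIndependent ℤ (fun a : b.support => P.coroot a) := b.linearIndepOn_coroot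
  have hsp : ⊤ ≤ Submodule.span ℤ (Set.range fun a : b.support => P.coroot a) := by
    have h := b.span_int_coroot_support
    have h2 : (Set.range fun a : b.support => P.coroot a) = P.coroot '' b.support := by
      ext x; simp
    rw [h2, h]; exact hN.ge
  refine ⟨fun a => P.toPerfPair.symm ((Basis.mk hli hsp).coord a), fun a a' => ?_⟩
  change P.toPerfPair (P.toPerfPair.symm _) _ = _
  rw [LinearEquiv.apply_symm_apply]
  have h3 : P.coroot a' = Basis.mk hli hsp a' := by simp
  rw [h3, Basis.coord_apply, Basis.repr_self, Finsupp.single_apply]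

lemma Base.toLinearMap_coroot_eq_height {ρ : M}
    (hρ : ∀ a ∈ b.support, P.toLinearMap ρ (P.coroot a) = 1) (i : ι) :
    P.toLinearMap ρ (P.coroot i) = b.flip.height i := by
  obtain ⟨f, -, -, hf⟩ := b.flip.exists_root_eq_sum_int i
  rw [Base.height_eq_sum (b := b.flip) hf]
  change P.coroot i = ∑ j ∈ b.support, f j • P.coroot j at hf
  rw [hf, map_sum]
  refine Finset.sum_congr rfl fun j hj => ?_
  rw [map_smul, hρ j hj, smul_eq_mul, mul_one]

/-- The sum of the fundamental weights works. For `K` above all heights, `nρ / K` is an interior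
point of the alcove dilated by `n`. -/
lemma Base.exists_weight_eq_height (hN : P.corootSpan ℤ = ⊤) :
    ∃ ρ : M, ∀ i, P.toLinearMap ρ (P.coroot i) = b.flip.height i := by
  obtain ⟨ω, hω⟩ := b.exists_fundamentalWeight hN
  refine ⟨∑ a, ω a, b.toLinearMap_coroot_eq_height fun a ha => ?_⟩
  rw [map_sum, LinearMap.sum_apply, Finset.sum_congr rfl fun a' _ => hω a' ⟨a, ha⟩]
  simp

lemma Base.coroot_mem_closure_of_isPos {i : ι} (hi : b.flip.IsPos i) :
    P.coroot i ∈ AddSubmonoid.closure (P.coroot '' b.support) := by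
  obtain ⟨f, -, hf | hf⟩ := b.flip.exists_root_eq_sum_nat_or_neg i
  · change P.coroot i = ∑ j ∈ b.support, f j • P.coroot j at hf
    rw [hf]
    exact sum_mem fun j hj => nsmul_mem (AddSubmonoid.subset_closure (Set.mem_image_of_mem _ hj)) _
  · have h1 := Base.height_eq_sum (b := b.flip) (i := i) (f := fun j => -(f j : ℤ))
      (by rw [hf]; simp)
    rw [Base.isPos_iff, h1, Finset.sum_neg_distrib] at hi
    have : 0 ≤ ∑ j ∈ b.flip.support, (f j : ℤ) := Finset.sum_nonneg fun j _ => by positivity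
    linarith

lemma nonneg_of_mem_closure {s : Set N} {x : M} (hx : ∀ y ∈ s, 0 ≤ P.toLinearMap x y) {y : N}
    (hy : y ∈ AddSubmonoid.closure s) : 0 ≤ P.toLinearMap x y := by
  induction hy using AddSubmonoid.closure_induction with
  | mem y hy => exact hx y hy
  | zero => simp
  | add y z _ _ h1 h2 => rw [map_add]; exact add_nonneg h1 h2

lemma smul_sub_mem_rootSpan {g : P.Aut} (hg : g ∈ P.weylGroup) (x : M) :
    g • x - x ∈ P.rootSpan ℤ := by
  revert x
  induction hg using weylGroup.induction with
  | mem i =>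
    intro x
    rw [reflection_smul_eq, sub_sub_cancel_left]
    exact neg_mem (Submodule.smul_mem _ _ (Submodule.subset_span ⟨i, rfl⟩))
  | one => simp
  | mul g h _ _ h1 h2 =>
    intro x
    have := add_mem (h1 (h • x)) (h2 x)
    rwa [sub_add_sub_cancel, ← mul_smul] at this

lemma smul_mem_rootSpan (g : P.Aut) {x : M} (hx : x ∈ P.rootSpan ℤ) :
    g • x ∈ P.rootSpan ℤ := by
  induction hx using Submodule.span_induction with
  | mem x hx =>
    obtain ⟨i, rfl⟩ := hx
    rw [aut_smul_root]
    exact Submodule.subset_span ⟨_, rfl⟩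
  | zero => rw [smul_zero]; exact zero_mem _
  | add x y _ _ h1 h2 => rw [smul_add]; exact add_mem h1 h2
  | smul c x _ h => rw [aut_smul_zsmul]; exact Submodule.smul_mem _ _ h

end Weights

-- The dilated alcove and affine stabilizers.

section Alcove

variable {ι M N : Type*} [Fintype ι] [AddCommGroup M] [AddCommGroup N]
  {P : RootPairing ι ℤ M N} (b : P.Base)

/-- Every weight can be moved into the closed fundamental alcove, dilated by `n`, by the affine
Weyl group. -/
lemma Base.exists_smul_add_mem_alcove {ρ : M} {K n : ℤ}
    (hρ : ∀ i, b.flip.IsPos i → 0 < P.toLinearMap ρ (P.coroot i))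
    (hK : ∀ i, P.toLinearMap ρ (P.coroot i) < K) (hK0 : 0 < K) (hn : 0 < n) (ξ : M) :
    ∃ g ∈ P.weylGroup, ∃ μ ∈ P.rootSpan ℤ, ∀ i, b.flip.IsPos i →
      0 ≤ P.toLinearMap (g • ξ + n • μ) (P.coroot i) ∧
        P.toLinearMap (g • ξ + n • μ) (P.coroot i) ≤ n := by
  -- Minimize the distance to the interior point `nρ / K` over the affine orbit, scaled by `K` to
  -- stay integral. A wall separating `v` from that point would give a nearer reflected point.
  obtain ⟨v, ⟨g, hg, μ, hμ, rfl⟩, hmin⟩ := exists_forall_le_of_nonneg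
    (fun v : M => P.RootForm (K • v - n • ρ) (K • v - n • ρ))
    (fun v => P.rootForm_self_nonneg _)
    (fun v => ∃ g ∈ P.weylGroup, ∃ μ ∈ P.rootSpan ℤ, v = g • ξ + n • μ)
    ⟨ξ, 1, one_mem _, 0, zero_mem _, by simp⟩
  refine ⟨g, hg, μ, hμ, fun i hi => ?_⟩
  set v := g • ξ + n • μ with hv
  have h1 := hρ i hi
  have h2 := hK i
  have hq := P.rootForm_root_self_pos i
  have hroot : P.root i ∈ P.rootSpan ℤ := Submodule.subset_span ⟨i, rfl⟩
  set t := P.toLinearMap v (P.coroot i) with ht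
  have key : ∀ m : ℤ, (∃ g ∈ P.weylGroup, ∃ μ ∈ P.rootSpan ℤ, v - m • P.root i = g • ξ + n • μ) →
      0 ≤ m * (K * m - (K * t - n * P.toLinearMap ρ (P.coroot i))) := by
    intro m hm
    have h3 := hmin _ hm
    have h4 : K • (v - m • P.root i) - n • ρ = (K • v - n • ρ) - (K * m) • P.root i := by
      clear_value v
      module
    rw [h4, rootForm_sub_smul_root] at h3
    simp only [map_sub, map_smul, LinearMap.sub_apply, LinearMap.smul_apply, smul_eq_mul] at h3
    rw [← ht] at h3
    have h5 : 0 ≤ (K * (m * (K * m - (K * t - n * P.toLinearMap ρ (P.coroot i))))) *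
      P.RootForm (P.root i) (P.root i) := by linarith
    exact nonneg_of_mul_nonneg_right (nonneg_of_mul_nonneg_left h5 hq) hK0
  constructor
  · by_contra hneg
    push Not at hneg
    -- Subtracting `t` times the root is the linear reflection; below, `t - n` gives the reflection
    -- in the hyperplane where the coroot takes the value `n`.
    have h6 := key t ⟨Equiv.reflection P i * g, mul_mem (P.reflection_mem_weylGroup i) hg,
      Equiv.reflection P i • μ, smul_mem_rootSpan _ hμ, by
        rw [mul_smul, ← aut_smul_zsmul, ← smul_add, ← hv, reflection_smul_eq]⟩
    have h7 : 0 < n * P.toLinearMap ρ (P.coroot i) := mul_pos hn h1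
    nlinarith
  · by_contra hlt
    push Not at hlt
    have h6 := key (t - n) ⟨Equiv.reflection P i * g, mul_mem (P.reflection_mem_weylGroup i) hg,
      Equiv.reflection P i • μ + P.root i, add_mem (smul_mem_rootSpan _ hμ) hroot, by
        rw [mul_smul, smul_add n, ← aut_smul_zsmul, ← add_assoc, ← smul_add, ← hv,
          reflection_smul_eq, ← ht]
        clear_value v t
        module⟩
    have h7 : 0 < n * (K - P.toLinearMap ρ (P.coroot i)) := mul_pos hn (by linarith)
    nlinarith

variable [P.IsReduced] [Module.Free ℤ M] [Module.Free ℤ N]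

/-- An element of the affine Weyl group that fixes a point of the closed fundamental alcove and
permutes the chambers at this point trivially is trivial. -/
lemma Base.eq_one_of_smul_eq_add {ρ : M} {K n : ℤ}
    (hρ : ∀ i, b.flip.IsPos i → 0 < P.toLinearMap ρ (P.coroot i))
    (hK : ∀ i, P.toLinearMap ρ (P.coroot i) < K) (hn : 0 < n) {ξ μ : M}
    (hξ : ∀ i, b.flip.IsPos i → 0 ≤ P.toLinearMap ξ (P.coroot i) ∧
      P.toLinearMap ξ (P.coroot i) ≤ n)
    {w : P.Aut} (hw : w ∈ P.weylGroup) (hμ : μ ∈ P.rootSpan ℤ) (hwξ : w • ξ = ξ + n • μ)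
    (hsign : ∀ i, n ∣ P.toLinearMap ξ (P.coroot i) →
      0 ≤ P.toLinearMap (w • (n • ρ - K • ξ)) (P.coroot i) *
        P.toLinearMap (n • ρ - K • ξ) (P.coroot i)) : w = 1 := by
  have hdich : ∀ i, b.flip.IsPos i ∨
      ((-n ≤ P.toLinearMap ξ (P.coroot i) ∧ P.toLinearMap ξ (P.coroot i) ≤ 0) ∧
      (-K < P.toLinearMap ρ (P.coroot i) ∧ P.toLinearMap ρ (P.coroot i) < 0)) := by
    intro i
    by_cases hi : b.flip.IsPos i
    · exact Or.inl hi
    · have h1 : b.flip.IsPos (P.reflectionPerm i i) := (Base.IsPos.neg_iff_not b.flip i).2 hi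
      have h2 := hξ _ h1
      have h3 := hρ _ h1
      have h4 := hK (P.reflectionPerm i i)
      rw [toLinearMap_coroot_reflectionPerm_self] at h2 h3 h4
      right
      constructor <;> constructor <;> linarith
  -- The affine map `v ↦ w v - n μ` fixes `ξ`, so `ξ` takes the value `t + n m` on `w⁻¹ • i`. The
  -- alcove bounds leave three values of `m` for each sign of `w⁻¹ • i`; the unwanted ones force `t
  -- = 0` or `t = n`, where `hsign` excludes them.
  have hval : ∀ i, b.flip.IsPos i →
      (P.toLinearMap μ (P.coroot i) = 0 ∧ b.flip.IsPos (w⁻¹ • i)) ∨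
        P.toLinearMap μ (P.coroot i) = -1 := by
    intro i hi
    set j := w⁻¹ • i with hj
    set m := P.toLinearMap μ (P.coroot i) with hm
    set t := P.toLinearMap ξ (P.coroot i) with ht
    have ht' : P.toLinearMap ξ (P.coroot j) = t + n * m := by
      rw [hj, ← toLinearMap_aut_smul, hwξ]
      simp [← ht, ← hm]
    obtain ⟨h0, h1⟩ := hξ i hi
    have h2 := hρ i hi
    have h3 := hK i
    have hs := hsign i
    rw [toLinearMap_aut_smul, ← hj] at hs
    simp only [map_sub, map_smul, LinearMap.sub_apply, LinearMap.smul_apply, smul_eq_mul,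
      ht', ← ht] at hs h0 h1
    set r := P.toLinearMap ρ (P.coroot i)
    set r' := P.toLinearMap ρ (P.coroot j) with hr'
    have h4 : r' < K := hK j
    have ht0 : t = 0 → 0 ≤ n * r' - K * (t + n * m) := by
      intro h
      have := hs (by rw [h]; exact dvd_zero n)
      rw [h] at this ⊢
      have h5 : 0 < n * r - K * 0 := by nlinarith
      exact nonneg_of_mul_nonneg_left this h5
    have htn : t = n → n * r' - K * (t + n * m) ≤ 0 := by
      intro h
      have := hs (by rw [h])
      rw [h] at this ⊢
      have h5 : n * r - K * n < 0 := by nlinarith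
      exact nonpos_of_mul_nonneg_left this h5
    rcases hdich j with hjp | ⟨⟨h6, h7⟩, h8, h9⟩
    · obtain ⟨h6, h7⟩ := hξ j hjp
      have h8 := hρ j hjp
      rw [ht'] at h6 h7
      left
      refine ⟨?_, hjp⟩
      have hm1 : -1 ≤ m := by nlinarith
      have hm2 : m ≤ 1 := by nlinarith
      obtain h | h | h : m = -1 ∨ m = 0 ∨ m = 1 := by omega
      · have h10 : t = n := by rw [h] at h6; linarith
        have := htn h10
        rw [h, h10] at this
        nlinarith
      · exact h
      · have h10 : t = 0 := by rw [h] at h7; linarith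
        have := ht0 h10
        rw [h, h10] at this
        nlinarith
    · rw [ht'] at h6 h7
      right
      have hm1 : -2 ≤ m := by nlinarith
      have hm2 : m ≤ 0 := by nlinarith
      obtain h | h | h : m = -2 ∨ m = -1 ∨ m = 0 := by omega
      · have h10 : t = n := by rw [h] at h6; linarith
        have := htn h10
        rw [h, h10] at this
        nlinarith
      · exact h
      · have h10 : t = 0 := by rw [h] at h7; linarith
        have := ht0 h10
        rw [h, h10] at this
        nlinarith
  have hμ0 : μ = 0 := by
    refine eq_zero_of_mem_rootSpan_of_le_one hμ fun i => ?_
    by_cases hi : b.flip.IsPos i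
    · rcases hval i hi with ⟨h, -⟩ | h <;> rw [h] <;> norm_num
    · have h1 : b.flip.IsPos (P.reflectionPerm i i) := (Base.IsPos.neg_iff_not b.flip i).2 hi
      have h2 := hval _ h1
      rw [toLinearMap_coroot_reflectionPerm_self] at h2
      rcases h2 with ⟨h, -⟩ | h <;> linarith
  rw [← inv_eq_one]
  refine b.eq_one_of_forall_isPos (inv_mem hw) fun i hi => ?_
  rcases hval i hi with ⟨-, h⟩ | h
  · exact h
  · simp [hμ0] at h

/-- The stabilizer of a point of the closed fundamental alcove in the affine Weyl group is
generated by reflections; so a weight whose stabilizer contains these is fixed. -/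
lemma Base.smul_eq_of_smul_eq_add {ρ : M} {K n : ℤ}
    (hρ : ∀ i, b.flip.IsPos i → 0 < P.toLinearMap ρ (P.coroot i))
    (hK : ∀ i, P.toLinearMap ρ (P.coroot i) < K) (hn : 0 < n) {ξ ξ' μ : M}
    (hξ : ∀ i, b.flip.IsPos i → 0 ≤ P.toLinearMap ξ (P.coroot i) ∧
      P.toLinearMap ξ (P.coroot i) ≤ n)
    (hξ' : ∀ i, n ∣ P.toLinearMap ξ (P.coroot i) → P.toLinearMap ξ' (P.coroot i) = 0)
    {w : P.Aut} (hw : w ∈ P.weylGroup) (hμ : μ ∈ P.rootSpan ℤ) (hwξ : w • ξ = ξ + n • μ) :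
    w • ξ' = ξ' := by
  set δ := n • ρ - K • ξ with hδ
  -- `δ` points from `ξ` towards `nρ / K`. The competitors `r` are closed under left multiplication
  -- by reflections in the walls through `ξ`, so bringing `(r * w) • δ` nearest to `δ` puts both on
  -- the same side of each of these walls, whence `r * w = 1`.
  obtain ⟨r, ⟨hr, ⟨ν, hν, hrξ⟩, hrξ'⟩, hmin⟩ := exists_forall_le_of_nonneg
    (fun r : P.Aut => P.RootForm ((r * w) • δ - δ) ((r * w) • δ - δ))
    (fun r => P.rootForm_self_nonneg _)
    (fun r => r ∈ P.weylGroup ∧ (∃ ν ∈ P.rootSpan ℤ, r • ξ = ξ + n • ν) ∧ r • ξ' = ξ')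
    ⟨1, one_mem _, ⟨0, zero_mem _, by simp⟩, one_smul _ _⟩
  have hone : r * w = 1 := by
    refine b.eq_one_of_smul_eq_add hρ hK hn hξ (mul_mem hr hw)
      (add_mem hν (smul_mem_rootSpan r hμ)) ?_ ?_
    · rw [mul_smul, hwξ, smul_add, hrξ, aut_smul_zsmul]
      generalize r • μ = μ'
      module
    · intro i hi
      rw [← hδ]
      obtain ⟨c, hc⟩ := id hi
      have h1 := hmin (Equiv.reflection P i * r) ⟨mul_mem (P.reflection_mem_weylGroup i) hr,
        ⟨Equiv.reflection P i • ν - c • P.root i,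
          sub_mem (smul_mem_rootSpan _ hν)
            (Submodule.smul_mem _ _ (Submodule.subset_span ⟨i, rfl⟩)), by
          rw [mul_smul, hrξ, smul_add, aut_smul_zsmul, reflection_smul_eq P i ξ, hc]
          generalize Equiv.reflection P i • ν = ν'
          module⟩, by
          rw [mul_smul, hrξ', reflection_smul_eq, hξ' i hi, zero_smul, sub_zero]⟩
      have h2 : (Equiv.reflection P i * r * w) • δ - δ = ((r * w) • δ - δ)
          - P.toLinearMap ((r * w) • δ) (P.coroot i) • P.root i := by
        rw [mul_assoc, mul_smul, reflection_smul_eq]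
        abel
      rw [h2, rootForm_sub_smul_root] at h1
      have h3 := P.rootForm_root_self_pos i
      rw [map_sub P.toLinearMap, LinearMap.sub_apply, sub_sub_cancel] at h1
      exact nonneg_of_mul_nonneg_left (by linarith) h3
  rw [mul_eq_one_iff_inv_eq] at hone
  rw [← hone, inv_smul_eq_iff, hrξ']

end Alcove

-- Fixed weights in a class modulo `n`.

section Congruence

variable {ι M N : Type*} [AddCommGroup M] [AddCommGroup N]
  {P : RootPairing ι ℤ M N} (b : P.Base)

/-- A point of the closed fundamental alcove is congruent modulo `n` to a weight that vanishes on
all coroots on which the given point is divisible by `n`, provided that `n` is coprime to the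
coefficients of the highest coroot. -/
lemma Base.exists_modEq_of_mem_alcove (hN : P.corootSpan ℤ = ⊤) {n : ℤ} (hn : 0 < n)
    {θ : ι} (hθ : BDCover.IsHighestCoroot b θ) {c : b.support → ℤ}
    (hc : P.coroot θ = ∑ a, c a • P.coroot a) (hcop : ∀ a, IsCoprime n (c a)) {ξ : M}
    (hξ : ∀ i, b.flip.IsPos i → 0 ≤ P.toLinearMap ξ (P.coroot i) ∧
      P.toLinearMap ξ (P.coroot i) ≤ n) :
    ∃ ξ' : M, (∃ ν : M, ξ' = ξ + n • ν) ∧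
      ∀ i, n ∣ P.toLinearMap ξ (P.coroot i) → P.toLinearMap ξ' (P.coroot i) = 0 := by
  classical
  have hdom : ∀ y ∈ P.coroot '' b.support, 0 ≤ P.toLinearMap ξ y := by
    rintro _ ⟨a, ha, rfl⟩
    exact (hξ a (Base.isPos_of_mem_support (b := b.flip) ha)).1
  have hpos : ∀ ξ' : M, (∀ i, b.flip.IsPos i → n ∣ P.toLinearMap ξ (P.coroot i) →
      P.toLinearMap ξ' (P.coroot i) = 0) →
      ∀ i, n ∣ P.toLinearMap ξ (P.coroot i) → P.toLinearMap ξ' (P.coroot i) = 0 := by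
    intro ξ' h i hi
    by_cases hp : b.flip.IsPos i
    · exact h i hp hi
    · have h1 := h _ ((Base.IsPos.neg_iff_not b.flip i).2 hp)
      change n ∣ P.toLinearMap ξ (P.coroot (P.reflectionPerm i i)) →
        P.toLinearMap ξ' (P.coroot (P.reflectionPerm i i)) = 0 at h1
      rw [toLinearMap_coroot_reflectionPerm_self, toLinearMap_coroot_reflectionPerm_self,
        dvd_neg, neg_eq_zero] at h1
      exact h1 hi
  have hle : ∀ i, P.toLinearMap ξ (P.coroot i) ≤ P.toLinearMap ξ (P.coroot θ) := by
    intro i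
    have := nonneg_of_mem_closure hdom (hθ i)
    rw [map_sub] at this
    linarith
  have hθpos : b.flip.IsPos θ := by
    obtain ⟨ρ, hρ⟩ := b.exists_weight_eq_height hN
    have h1 : 0 ≤ P.toLinearMap ρ (P.coroot θ - P.coroot (P.reflectionPerm θ θ)) := by
      refine nonneg_of_mem_closure ?_ (hθ _)
      rintro _ ⟨a, ha, rfl⟩
      rw [hρ]
      exact (Base.isPos_of_mem_support (b := b.flip) ha).le
    rw [map_sub, toLinearMap_coroot_reflectionPerm_self, hρ] at h1
    rw [Base.isPos_iff']
    linarith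
  -- Off the upper wall, divisibility by `n` on a positive coroot means vanishing, so `ξ` itself
  -- serves. On it, a fundamental weight corrects `ξ`.
  rcases lt_or_eq_of_le (hξ θ hθpos).2 with hlt | heq
  · refine ⟨ξ, ⟨0, by simp⟩, hpos ξ fun i hi hdvd => ?_⟩
    have h1 := (hξ i hi).1
    have h2 := hle i
    exact Int.eq_zero_of_dvd_of_nonneg_of_lt h1 (by linarith) hdvd
  · obtain ⟨ω, hω⟩ := b.exists_fundamentalWeight hN
    obtain ⟨a, ha⟩ : ∃ a : b.support, 0 < P.toLinearMap ξ (P.coroot a) := by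
      by_contra hcon
      push Not at hcon
      rw [hc, map_sum] at heq
      have : ∀ a : b.support, P.toLinearMap ξ (c a • P.coroot a) = 0 := fun a => by
        rw [map_smul, le_antisymm (hcon a) (hdom _ ⟨a, a.2, rfl⟩), smul_zero]
      rw [Finset.sum_eq_zero fun a _ => this a] at heq
      omega
    have hωθ : P.toLinearMap (ω a) (P.coroot θ) = c a := by
      rw [hc, map_sum, Finset.sum_eq_single a]
      · rw [map_smul, hω]; simp
      · intro a' _ h
        rw [map_smul, hω, if_neg h, smul_zero]
      · simp
    have hω0 : ∀ y ∈ P.coroot '' b.support, 0 ≤ P.toLinearMap (ω a) y := by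
      rintro _ ⟨a', ha', rfl⟩
      have := hω a ⟨a', ha'⟩
      change P.toLinearMap (ω a) (P.coroot a') = _ at this
      rw [this]
      split_ifs <;> norm_num
    have hω1 : ∀ y ∈ P.coroot '' b.support,
        0 ≤ P.toLinearMap (ξ - P.toLinearMap ξ (P.coroot a) • ω a) y := by
      rintro _ ⟨a', ha', rfl⟩
      have := hω a ⟨a', ha'⟩
      change P.toLinearMap (ω a) (P.coroot a') = _ at this
      rw [map_sub, LinearMap.sub_apply, map_smul, LinearMap.smul_apply, this, smul_eq_mul]
      split_ifs with h
      · rw [← h]; simp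
      · simpa using hdom _ ⟨a', ha', rfl⟩
    -- On the positive cone `ξ` dominates a positive multiple of `ω a`.
    have hzero : ∀ y ∈ AddSubmonoid.closure (P.coroot '' b.support), P.toLinearMap ξ y = 0 →
        P.toLinearMap (ω a) y = 0 := by
      intro y hy h0
      have h1 := nonneg_of_mem_closure hω0 hy
      have h2 := nonneg_of_mem_closure hω1 hy
      rw [map_sub, LinearMap.sub_apply, map_smul, LinearMap.smul_apply, h0, smul_eq_mul] at h2
      nlinarith
    obtain ⟨v, u, huv⟩ := hcop a
    -- Here `v n + u c_a = 1`. Where `ξ` is 0, so is `ω a`; where `ξ` is `n`, the difference from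
    -- the highest coroot is killed by `ξ`, so `ω a` equals `c_a`. In both cases `c_a ξ - n ω_a`
    -- vanishes.
    refine ⟨u • (c a • ξ - n • ω a), ⟨-(v • ξ) - u • ω a, ?_⟩, hpos _ fun i hi hdvd => ?_⟩
    · have : u * c a = 1 - v * n := by linarith
      rw [smul_sub, ← mul_smul, this]
      module
    · rw [map_smul, LinearMap.smul_apply, map_sub, LinearMap.sub_apply, map_smul, map_smul,
        LinearMap.smul_apply, LinearMap.smul_apply]
      obtain ⟨h1, h2⟩ := hξ i hi
      have hval : P.toLinearMap ξ (P.coroot i) = 0 ∨ P.toLinearMap ξ (P.coroot i) = n := by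
        rcases lt_or_eq_of_le h2 with h | h
        · exact Or.inl (Int.eq_zero_of_dvd_of_nonneg_of_lt h1 h hdvd)
        · exact Or.inr h
      rcases hval with h | h
      · rw [h, hzero _ (b.coroot_mem_closure_of_isPos hi) h]
        simp
      · have h3 := hzero _ (hθ i) (by rw [map_sub, heq, h, sub_self])
        rw [map_sub, hωθ, sub_eq_zero] at h3
        rw [h, ← h3]
        simp only [smul_eq_mul]
        ring

variable [Fintype ι] [Module.Free ℤ M] [Module.Free ℤ N] [P.IsReduced]

/-- If `n` is coprime to the coefficients of the highest coroot and to the exponent of the weight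
lattice modulo the root lattice, then every class of weights modulo `n` contains a weight that is
fixed by the stabilizer of the class. -/
theorem Base.exists_modEq_forall_smul_eq (hN : P.corootSpan ℤ = ⊤) {n k : ℤ} (hn : 0 < n)
    (hk : ∀ x : M, k • x ∈ P.rootSpan ℤ) (hkn : IsCoprime k n)
    {θ : ι} (hθ : BDCover.IsHighestCoroot b θ) {c : b.support → ℤ}
    (hc : P.coroot θ = ∑ a, c a • P.coroot a) (hcop : ∀ a, IsCoprime n (c a)) (ξ : M) :
    ∃ ξ' : M, (∃ ν : M, ξ' = ξ + n • ν) ∧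
      ∀ w ∈ P.weylGroup, (∃ ν : M, w • ξ = ξ + n • ν) → w • ξ' = ξ' := by
  obtain ⟨ρ, hρ⟩ := b.exists_weight_eq_height hN
  have hρpos : ∀ i, b.flip.IsPos i → 0 < P.toLinearMap ρ (P.coroot i) := fun i hi => by
    rw [hρ]; exact hi
  obtain ⟨K, hK0, hK⟩ : ∃ K : ℤ, 0 < K ∧ ∀ i, P.toLinearMap ρ (P.coroot i) < K := by
    refine ⟨1 + ∑ i, |P.toLinearMap ρ (P.coroot i)|, ?_, fun i => ?_⟩
    · have : 0 ≤ ∑ i, |P.toLinearMap ρ (P.coroot i)| := Finset.sum_nonneg fun i _ => abs_nonneg _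
      linarith
    · have h1 := Finset.single_le_sum (f := fun i => |P.toLinearMap ρ (P.coroot i)|)
        (fun i _ => abs_nonneg _) (Finset.mem_univ i)
      have h2 := le_abs_self (P.toLinearMap ρ (P.coroot i))
      linarith
  obtain ⟨g, hg, μ, -, halc⟩ := b.exists_smul_add_mem_alcove hρpos hK hK0 hn ξ
  obtain ⟨ζ, ⟨ν, hν⟩, hζ⟩ := b.exists_modEq_of_mem_alcove hN hn hθ hc hcop halc
  refine ⟨g⁻¹ • ζ, ⟨g⁻¹ • (μ + ν), ?_⟩, ?_⟩
  · rw [hν, smul_add, smul_add, inv_smul_smul, aut_smul_zsmul, aut_smul_zsmul, smul_add, smul_add,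
      add_assoc]
  · rintro w hw ⟨τ, hτ⟩
    have hw' : g * w * g⁻¹ ∈ P.weylGroup := mul_mem (mul_mem hg hw) (inv_mem hg)
    set w' := g * w * g⁻¹ with hw'def
    have hgw : w' • (g • ξ + n • μ) = (g • ξ + n • μ) + n • (g • τ + w' • μ - μ) := by
      rw [smul_add, aut_smul_zsmul, hw'def, mul_smul, mul_smul, inv_smul_smul, hτ, smul_add,
        aut_smul_zsmul]
      generalize (g * w * g⁻¹) • μ = μ', g • τ = τ', g • ξ = ξ'
      module
    -- Both `n` and `k` times this vector lie in the root lattice, and they are coprime.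
    have hmem : g • τ + w' • μ - μ ∈ P.rootSpan ℤ := by
      obtain ⟨s, t, hst⟩ := hkn
      set σ := g • τ + w' • μ - μ
      have h1 : n • σ ∈ P.rootSpan ℤ := by
        have := smul_sub_mem_rootSpan hw' (g • ξ + n • μ)
        rwa [hgw, add_sub_cancel_left] at this
      have h2 : σ = s • k • σ + t • n • σ := by
        rw [← mul_smul, ← mul_smul, ← add_smul, hst, one_smul]
      rw [h2]
      exact add_mem (Submodule.smul_mem _ _ (hk σ)) (Submodule.smul_mem _ _ h1)
    have h3 := b.smul_eq_of_smul_eq_add hρpos hK hn halc hζ hw' hmem hgw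
    rw [hw'def, mul_smul, mul_smul] at h3
    rwa [eq_inv_smul_iff]

end Congruence

-- Passing between weights and coweights.

section Flip

variable {ι M N : Type*} [AddCommGroup M] [AddCommGroup N] (P : RootPairing ι ℤ M N)

/-- The contragredient of the action of an element of the Weyl group on coweights is the action of
an element of the Weyl group on weights. -/
lemma exists_weylGroup_toLinearMap_smul_smul {w : P.flip.Aut} (hw : w ∈ P.flip.weylGroup) :
    ∃ g ∈ P.weylGroup, ∀ (x : M) (y : N),
      P.toLinearMap (g • x) (w • y) = P.toLinearMap x y := by
  induction hw using weylGroup.induction with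
  | mem i =>
    refine ⟨_, P.reflection_mem_weylGroup i, fun x y => ?_⟩
    rw [reflection_smul_eq, reflection_smul_eq]
    change P.toLinearMap (x - P.toLinearMap x (P.coroot i) • P.root i)
      (y - P.toLinearMap (P.root i) y • P.coroot i) = _
    simp only [map_sub, map_smul, LinearMap.sub_apply, LinearMap.smul_apply, smul_eq_mul,
      P.root_coroot_two]
    ring
  | one => exact ⟨1, one_mem _, by simp⟩
  | mul w w' _ _ h h' =>
    obtain ⟨g, hg, H⟩ := h
    obtain ⟨g', hg', H'⟩ := h'
    exact ⟨g * g', mul_mem hg hg', fun x y => by rw [mul_smul, mul_smul, H, H']⟩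

open Classical in
-- These are `k` times the fundamental coweights: the coordinates of `k • x` in the simple roots are
-- integral functionals on `M`, hence come from `N`.
lemma Base.exists_coweight {P : RootPairing ι ℤ M N} (b : P.Base) {k : ℤ}
    (hk : ∀ x : M, k • x ∈ P.rootSpan ℤ) :
    ∃ z : b.support → N, ∀ a a' : b.support,
      P.toLinearMap (P.root a') (z a) = if a' = a then k else 0 := by
  refine ⟨fun a => P.flip.toPerfPair.symm (b.toWeightBasisInt.coord a ∘ₗ
    LinearMap.codRestrict (P.rootSpan ℤ) (k • LinearMap.id) hk), fun a a' => ?_⟩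
  change P.flip.toPerfPair (P.flip.toPerfPair.symm _) _ = _
  rw [LinearEquiv.apply_symm_apply]
  have h : LinearMap.codRestrict (P.rootSpan ℤ) (k • LinearMap.id) hk (P.root a')
      = k • b.toWeightBasisInt a' := by
    ext
    simp
  rw [LinearMap.comp_apply, h, map_smul, Basis.coord_apply, Basis.repr_self,
    Finsupp.single_apply]
  simp

end Flip

end RootPairing

-- Covers: splitting criteria and the two statements.

namespace BDCover

/-- The section `w • x ↦ w • y` is well defined. -/
lemma Cover.isSplitting_of_stabilizer_le {ι X Y : Type*} [AddCommGroup X] [AddCommGroup Y]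
    {P : RootDatum ι X Y} (C : Cover P) {x : C.XQn} (y : Y) (hy : C.proj y = x)
    (h : ∀ w : Weyl P, w • x = x → w • y = y) : C.IsSplitting x := by
  subst hy
  have key : ∀ o : MulAction.orbit (Weyl P) (C.proj y), ∃ w : Weyl P, w • C.proj y = o :=
    fun o => o.2
  choose f hf using key
  refine ⟨fun o => f o • y, fun o => ?_, fun w o => ?_⟩
  · rw [← Cover.smul_mk, hf]
  · have h1 := h ((w * f o)⁻¹ * f (w • o)) (by
      rw [mul_smul, hf, inv_smul_eq_iff, mul_smul, hf]; rfl)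
    rw [mul_smul, inv_smul_eq_iff, mul_smul] at h1
    exact h1

namespace Cover

variable {ι X Y : Type*} [AddCommGroup X] [AddCommGroup Y] {P : RootDatum ι X Y} (C : Cover P)

lemma B_symm (y z : Y) : C.B y z = C.B z y := by
  rw [B_apply, B_apply, add_comm]

/-- Apply invariance under the reflection, which negates the coroot, and solve for the value. -/
lemma B_coroot (i : ι) (z : Y) :
    C.B (P.coroot i) z = C.Q (P.coroot i) * P.toLinearMap (P.root i) z := by
  have h := C.B_smul_smul (refl P i) (P.coroot i) z
  rw [refl_smul, refl_smul, P.root_coroot_two] at h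
  simp only [map_sub, map_smul, LinearMap.sub_apply, LinearMap.smul_apply, smul_eq_mul] at h
  have h2 : C.B (P.coroot i) (P.coroot i) = 2 * C.Q (P.coroot i) := by
    rw [B_apply, Q]; ring
  rw [h2] at h
  linarith

lemma exists_mem_rootSpan_of_mem_corootSpan {y : Y} (hy : y ∈ P.corootSpan ℤ) :
    ∃ η ∈ P.rootSpan ℤ, ∀ z, P.toLinearMap η z = C.B y z := by
  induction hy using Submodule.span_induction with
  | mem y hy =>
    obtain ⟨i, rfl⟩ := hy
    refine ⟨C.Q (P.coroot i) • P.root i,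
      Submodule.smul_mem _ _ (Submodule.subset_span ⟨i, rfl⟩), fun z => ?_⟩
    rw [B_coroot, map_smul, LinearMap.smul_apply, smul_eq_mul]
  | zero => exact ⟨0, zero_mem _, by simp⟩
  | add y y' _ _ h h' =>
    obtain ⟨η, hη, H⟩ := h
    obtain ⟨η', hη', H'⟩ := h'
    exact ⟨η + η', add_mem hη hη', fun z => by simp [H, H']⟩
  | smul c y _ h =>
    obtain ⟨η, hη, H⟩ := h
    exact ⟨c • η, Submodule.smul_mem _ _ hη, fun z => by simp [H]⟩

/-- Cramer's rule: the adjugate of the Gram matrix supplies the coordinates of `y`. -/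
lemma exists_B_eq_detB_mul [Module.Free ℤ Y] [Module.Finite ℤ Y] (f : Module.Dual ℤ Y) :
    ∃ y, ∀ z, C.B y z = C.detB * f z := by
  classical
  set v := Module.Free.chooseBasis ℤ Y
  set A : Matrix _ _ ℤ := Matrix.of fun i j => C.B (v i) (v j) with hA
  have hdet : C.detB = A.det := C.detB_eq v
  set c := Matrix.vecMul (fun i => f (v i)) A.adjugate with hc
  have hcA : Matrix.vecMul c A = A.det • fun i => f (v i) := by
    rw [hc, Matrix.vecMul_vecMul, Matrix.adjugate_mul, Matrix.vecMul_smul, Matrix.vecMul_one]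
  refine ⟨∑ i, c i • v i, fun z => ?_⟩
  have h : C.B (∑ i, c i • v i) = C.detB • f := by
    refine v.ext fun j => ?_
    have := congrFun hcA j
    simp only [Matrix.vecMul, dotProduct, hA, Matrix.of_apply, Pi.smul_apply] at this
    rw [hdet, LinearMap.smul_apply, ← this, map_sum, LinearMap.sum_apply]
    simp
  rw [h, LinearMap.smul_apply, smul_eq_mul]

lemma smul_proj_eq_iff (w : Weyl P) (y : Y) :
    w • C.proj y = C.proj y ↔ ∀ z, (C.n : ℤ) ∣ C.B (w • y - y) z := by
  rw [smul_mk, proj, proj, Submodule.Quotient.eq, mem_YQn]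

end Cover

lemma exists_eq_mul_of_forall_dvd {ι X Y : Type*} [AddCommGroup X] [AddCommGroup Y]
    (P : RootDatum ι X Y) {n : ℤ} (f : Module.Dual ℤ Y) (h : ∀ z, n ∣ f z) :
    ∃ ν : X, ∀ z, f z = n * P.toLinearMap ν z := by
  refine ⟨P.toPerfPair.symm (AddMonoidHom.mk' (fun z => f z / n) fun y z => by
    rw [map_add, Int.add_ediv_of_dvd_left (h y)]).toIntLinearMap, fun z => ?_⟩
  change _ = n * P.toPerfPair (P.toPerfPair.symm _) z
  rw [LinearEquiv.apply_symm_apply]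
  exact (Int.mul_ediv_cancel' (h z)).symm

lemma rootIndex_smul_mem_rootSpan {ι X Y : Type*} [AddCommGroup X] [AddCommGroup Y]
    {P : RootDatum ι X Y} (hsc : IsSimplyConnected P) (x : X) :
    (rootIndex P : ℤ) • x ∈ P.rootSpan ℤ := by
  have h := ((P.rootSpan ℤ).map (toWeightLattice P)).toAddSubgroup.nsmul_index_mem
    (toWeightLattice P x)
  obtain ⟨r, hr, hrx⟩ := h
  have : r = (rootIndex P : ℤ) • x := by
    apply P.toPerfPair.injective
    ext y
    have hy : y ∈ P.corootSpan ℤ := by rw [hsc]; exact Submodule.mem_top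
    have := LinearMap.congr_fun hrx ⟨y, hy⟩
    change P.toLinearMap r y = (rootIndex P • toWeightLattice P x) ⟨y, hy⟩ at this
    change P.toLinearMap r y = P.toLinearMap _ y
    rw [this, natCast_zsmul, map_nsmul, LinearMap.smul_apply, LinearMap.smul_apply]
    rfl
  rw [← this]
  exact hr

namespace Cover

variable {ι X Y : Type*} [AddCommGroup X] [AddCommGroup Y]
  {P : RootDatum ι X Y} (C : Cover P)

theorem IsOasitic.isSplitting [Fintype ι] [Module.Free ℤ X] [Module.Free ℤ Y] [Module.Finite ℤ Y]
    [P.IsReduced] {b : P.Base} (hsc : IsSimplyConnected P) (h : C.IsOasitic b) (x : C.XQn) :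
    C.IsSplitting x := by
  obtain ⟨⟨θ, hθ, c, hc, hcop⟩, hdet⟩ := h
  have hn : (0 : ℤ) < C.n := by exact_mod_cast C.n_pos
  obtain ⟨y, rfl⟩ := Submodule.Quotient.mk_surjective _ x
  obtain ⟨s, v, hsv⟩ := Int.isCoprime_iff_gcd_eq_one.2 hdet
  -- A zero determinant prime to `n` forces `n = 1`; the quotient is then trivial and 0 is a lift.
  by_cases h0 : C.detB = 0
  · refine C.isSplitting_of_stabilizer_le 0 ?_ fun w _ => smul_zero w
    rw [h0, mul_zero, add_zero] at hsv
    refine (Submodule.Quotient.eq _).2 fun z => ?_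
    exact (Dvd.intro_left s hsv).trans (one_dvd _)
  have hk : ∀ x : X, C.detB • x ∈ P.rootSpan ℤ := by
    intro x
    obtain ⟨y, hy⟩ := C.exists_B_eq_detB_mul (P.toLinearMap x)
    obtain ⟨η, hη, hηy⟩ := C.exists_mem_rootSpan_of_mem_corootSpan
      (y := y) (by rw [hsc]; exact Submodule.mem_top)
    have : η = C.detB • x := by
      apply P.toPerfPair.injective
      ext z
      change P.toLinearMap η z = P.toLinearMap _ z
      rw [hηy, hy, map_smul, LinearMap.smul_apply, smul_eq_mul]
    rwa [← this]
  have hnondeg : ∀ u : Y, (∀ z, C.B u z = 0) → u = 0 := by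
    intro u hu
    apply P.flip.toPerfPair.injective
    ext f
    obtain ⟨y, hy⟩ := C.exists_B_eq_detB_mul (P.toLinearMap f)
    have h1 := hy u
    rw [B_symm, hu] at h1
    have h2 : P.toLinearMap f u = 0 := by
      rcases mul_eq_zero.1 h1.symm with h | h
      · exact absurd h h0
      · exact h
    rw [map_zero]
    exact h2
  set ξ : X := P.toPerfPair.symm (C.B y) with hξdef
  have hξ : ∀ z, P.toLinearMap ξ z = C.B y z := fun z =>
    LinearMap.congr_fun (P.toPerfPair.apply_symm_apply (C.B y)) z
  obtain ⟨ξ', ⟨ν, hν⟩, hfix⟩ := b.exists_modEq_forall_smul_eq hsc hn hk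
    (Int.isCoprime_iff_gcd_eq_one.2 hdet).symm hθ hc
    (fun a => Int.isCoprime_iff_gcd_eq_one.2 (hcop a)) ξ
  obtain ⟨y', hy'⟩ := C.exists_B_eq_detB_mul (P.toLinearMap ξ')
  -- `B_Q(y', ·)` is `det B_Q` times `ξ'`, and `v` inverts `det B_Q` modulo `n`.
  refine C.isSplitting_of_stabilizer_le (v • y') ?_ fun w hw => ?_
  · refine (Submodule.Quotient.eq _).2 fun z => ?_
    refine ⟨P.toLinearMap ν z - s * P.toLinearMap ξ' z, ?_⟩
    have h1 := hy' z
    have h2 := hξ z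
    have h3 : P.toLinearMap ξ' z = P.toLinearMap ξ z + C.n * P.toLinearMap ν z := by
      rw [hν]; simp
    rw [map_sub, LinearMap.sub_apply, map_smul, LinearMap.smul_apply, smul_eq_mul, h1, ← h2]
    linear_combination (P.toLinearMap ξ' z) * hsv + h3
  · have hw' := (C.smul_proj_eq_iff w y).1 hw
    obtain ⟨g, hg, hgw⟩ := P.exists_weylGroup_toLinearMap_smul_smul w.2
    obtain ⟨τ, hτ⟩ := exists_eq_mul_of_forall_dvd P _ hw'
    have hgξ : g • ξ = ξ + (C.n : ℤ) • τ := by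
      apply P.toPerfPair.injective
      ext z
      change P.toLinearMap _ z = P.toLinearMap _ z
      have h1 := hgw ξ (w⁻¹ • z)
      have h2 : w.1 • w⁻¹ • z = z := smul_inv_smul w z
      rw [h2, hξ, ← C.B_smul_smul w, smul_inv_smul] at h1
      have h3 := hτ z
      rw [map_sub, LinearMap.sub_apply] at h3
      rw [h1, map_add P.toLinearMap, LinearMap.add_apply, map_smul P.toLinearMap,
        LinearMap.smul_apply, smul_eq_mul, hξ]
      linarith
    have hgξ' := hfix g hg ⟨τ, hgξ⟩
    have h4 : w • y' - y' = 0 := by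
      refine hnondeg _ fun z => ?_
      have h1 := hgw ξ' (w⁻¹ • z)
      have h2 : w.1 • w⁻¹ • z = z := smul_inv_smul w z
      rw [h2, hgξ'] at h1
      have h3 := C.B_smul_smul w y' (w⁻¹ • z)
      rw [smul_inv_smul, hy', ← h1, ← hy'] at h3
      rw [map_sub, LinearMap.sub_apply, h3, sub_self]
    have h5 : w • v • y' = v • w • y' := map_zsmul (DistribSMul.toAddMonoidHom Y w) v y'
    rw [h5, sub_eq_zero.1 h4]

theorem isSplitting_of_isParabolic_stabilizer (b : P.Base) (hsc : IsSimplyConnected P)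
    (hgcd : Nat.gcd C.n (rootIndex P) = 1) {x : C.XQn}
    (hx : IsParabolic b (MulAction.stabilizer (Weyl P) x)) : C.IsSplitting x := by
  classical
  obtain ⟨J, hJ, w₀, hstab⟩ := hx
  have hcop : IsCoprime (C.n : ℤ) (rootIndex P : ℤ) := Nat.isCoprime_iff_coprime.2 hgcd
  obtain ⟨z, hz⟩ := b.exists_coweight (rootIndex_smul_mem_rootSpan hsc)
  set k : ℤ := (rootIndex P : ℤ)
  obtain ⟨y, hy⟩ := Submodule.Quotient.mk_surjective _ (w₀⁻¹ • x)
  -- Test the invariance of the class of `y` under the reflection against `z a`; the resulting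
  -- factor `k` is prime to `n`.
  have hdvd : ∀ a : b.support, a.1 ∈ J →
      (C.n : ℤ) ∣ P.toLinearMap (P.root a) y * C.Q (P.coroot a) := by
    intro a ha
    have h1 : w₀ * refl P a * w₀⁻¹ ∈ MulAction.stabilizer (Weyl P) x := by
      rw [hstab]
      exact ⟨refl P a, Subgroup.subset_closure ⟨a, ha, rfl⟩, rfl⟩
    have h2 : refl P a • C.proj y = C.proj y := by
      rw [MulAction.mem_stabilizer_iff, mul_smul, mul_smul, ← eq_inv_smul_iff] at h1
      rwa [show C.proj y = w₀⁻¹ • x from hy]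
    have h3 := (C.smul_proj_eq_iff _ _).1 h2 (z a)
    rw [refl_smul, sub_sub_cancel_left, map_neg, LinearMap.neg_apply, dvd_neg, map_smul,
      LinearMap.smul_apply, B_coroot, hz, if_pos rfl, smul_eq_mul, ← mul_assoc] at h3
    exact hcop.dvd_of_dvd_mul_right h3
  obtain ⟨s, u, hsu⟩ := id hcop
  set m : b.support → ℤ := fun a => if a.1 ∈ J then P.toLinearMap (P.root a) y else 0 with hm
  -- Here `u k ≡ 1` modulo `n`, so `u • k • y` has the class of `y`. The correction cancels the
  -- pairings with the roots in `J`, and lies in `Y_{Q,n}` by `hdvd`.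
  set y' := u • (k • y - ∑ a, m a • z a) with hy'
  have hroot : ∀ a : b.support, a.1 ∈ J → P.toLinearMap (P.root a) y' = 0 := by
    intro a ha
    have : P.toLinearMap (P.root a) (∑ a', m a' • z a') = m a * k := by
      rw [map_sum, Finset.sum_eq_single a]
      · rw [map_smul, hz, if_pos rfl, smul_eq_mul]
      · intro a' _ h
        rw [map_smul, hz, if_neg h.symm, smul_zero]
      · simp
    rw [hy', map_smul, map_sub, this, map_smul, hm]
    simp [ha, mul_comm]
  have hproj : C.proj y' = w₀⁻¹ • x := by
    rw [← hy]
    refine (Submodule.Quotient.eq _).2 ?_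
    have h1 : y' - y = -(C.n * s : ℤ) • y - u • ∑ a, m a • z a := by
      have : u * k = 1 - C.n * s := by linarith
      rw [hy', smul_sub, ← mul_smul, this]
      module
    rw [h1]
    refine sub_mem ?_ (Submodule.smul_mem _ _ (sum_mem fun a _ => ?_))
    · intro t
      rw [map_smul, LinearMap.smul_apply, smul_eq_mul]
      exact ((Dvd.intro _ rfl).neg_right).mul_right _
    · have h2 : ∀ t ∈ P.corootSpan ℤ, (C.n : ℤ) ∣ C.B (m a • z a) t := by
        intro t ht
        replace ht := b.span_int_coroot_support.ge ht
        induction ht using Submodule.span_induction with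
        | mem t ht =>
          obtain ⟨a', ha', rfl⟩ := ht
          rw [B_symm, map_smul, B_coroot]
          have := hz a ⟨a', ha'⟩
          change P.toLinearMap (P.root a') _ = _ at this
          rw [this]
          by_cases haJ : a.1 ∈ J
          · split_ifs with h
            · have h3 := hdvd a haJ
              subst h
              simp only [hm, if_pos haJ, smul_eq_mul]
              rw [← mul_assoc]
              exact h3.mul_right _
            · simp
          · simp [hm, haJ]
        | zero => simp
        | add t t' _ _ h h' => rw [map_add]; exact dvd_add h h'
        | smul c t _ h => rw [map_smul]; exact h.mul_left c
      exact fun t => h2 t (by rw [hsc]; exact Submodule.mem_top)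
  have hfix : ∀ w ∈ standardParabolic P J, w • y' = y' := by
    intro w hw
    have hle : standardParabolic P J ≤ MulAction.stabilizer (Weyl P) y' := by
      rw [standardParabolic, Subgroup.closure_le]
      rintro _ ⟨i, hi, rfl⟩
      rw [SetLike.mem_coe, MulAction.mem_stabilizer_iff, refl_smul, hroot ⟨i, hJ hi⟩ hi, zero_smul,
        sub_zero]
    exact hle hw
  refine C.isSplitting_of_stabilizer_le (w₀ • y') ?_ fun w hw => ?_
  · rw [← smul_mk, hproj, smul_inv_smul]
  · have hw' : w ∈ MulAction.stabilizer (Weyl P) x := hw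
    rw [hstab] at hw'
    obtain ⟨h, hh, rfl⟩ := hw'
    change (w₀ * h * w₀⁻¹) • w₀ • y' = w₀ • y'
    rw [mul_smul, inv_smul_smul, mul_smul, hfix h hh]

end Cover

end BDCover

theorem corollary6p4 {ι X Y : Type*} [Fintype ι] [AddCommGroup X] [AddCommGroup Y]
    [Module.Free ℤ X] [Module.Finite ℤ X] [Module.Free ℤ Y] [Module.Finite ℤ Y]
    (P : RootDatum ι X Y) [P.IsReduced] (b : P.Base)
    (hsimple : BDCover.IsAlmostSimple P) (hsc : BDCover.IsSimplyConnected P)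
    (C : BDCover.Cover P)
    (hQ : ∀ i, BDCover.IsShortCoroot P i → C.Q (P.coroot i) = 1) :
    (C.IsOasitic b → ∀ x : C.XQn, C.IsSplitting x) ∧
    (Nat.gcd C.n (BDCover.rootIndex P) = 1 →
      ∀ x : C.XQn, BDCover.IsParabolic b (MulAction.stabilizer (BDCover.Weyl P) x) →
        C.IsSplitting x) :=
  ⟨fun h x => BDCover.Cover.IsOasitic.isSplitting C hsc h x,
    fun h _ hx => C.isSplitting_of_isParabolic_stabilizer b hsc h hx⟩
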